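/- For an integer polynomial $P$ let $H(P)$ be the maximum of the absolute values of its coefficients, and for a real algebraic number $\alpha$ let $H(\alpha)=H(P)$, where $P$ is the minimal polynomial of $\alpha$ over $\mathbb{Z}$ with coprime coefficients. For a positive integer $n$ and a real transcendental number $\zeta$, let $w_n(\zeta)$ (respectively $\widehat{w}_n(\zeta)$) be the supremum in $\mathbb{R}\cup\{+\infty\}$ of the real $\eta$ such that the system $$H(P)\le X,\qquad 0<|P(\zeta)|\le X^{-\eta}$$ has a solution $P\in\mathbb{Z}[T]$ of degree at most $n$ for arbitrarily large $X$ (respectively, for all sufficiently large $X$). Let $w_n^*(\zeta)$ be the supremum in $\mathbb{R}\cup\{+\infty\}$ of the real $\eta$ such that $$0<|\zeta-\alpha|\le H(\alpha)^{-\eta-1}$$ has infinitely many solutions in real algebraic numbers $\alpha$ of degree at most $n$. **Theorem.** Let $\zeta$ be a real transcendental number. 1. For all positive integers $m,n$, $$w^*_{m+n-1}(\zeta)\ \ge\ \min\{w_m(\zeta),\widehat{w}_n(\zeta)\}.$$ 2. In particular, for every positive integer $n$, $\ w_n^*(\zeta)\ge \widehat{w}_{\lceil n/2\rceil}(\zeta)$.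 3. The approximating algebraic numbers can be replaced by algebraic integers of degree one higher: for all positive integers $m,n$ and every real $\eta<\min\{w_m(\zeta),\widehat{w}_n(\zeta)\}$, there are infinitely many real algebraic integers $\alpha$ of degree exactly $m+n$ with $$0<|\zeta-\alpha|\le H(\alpha)^{-\eta-1};$$ likewise, for every positive integer $n$ and every real $\eta<\widehat{w}_{\lceil n/2\rceil}(\zeta)$, there are infinitely many such real algebraic integers $\alpha$ of degree exactly $n+1$. -/

import Mathlib

open Polynomial Filter

/-- The naive height of an integer polynomial: the maximum of the absolute values of its
coefficients. -/
def polyHeight (P : ℤ[X]) : ℕ :=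
  P.support.sup fun i => (P.coeff i).natAbs

/-- The minimal polynomial of a real algebraic number `α` over `ℤ` with coprime coefficients
(determined up to sign): clear the denominators of the minimal polynomial over `ℚ` and divide by
the content. -/
noncomputable def intMinpoly (α : ℝ) : ℤ[X] :=
  (IsLocalization.integerNormalization (nonZeroDivisors ℤ) (minpoly ℚ α)).primPart

/-- The height of a real algebraic number. -/
noncomputable def algHeight (α : ℝ) : ℕ :=
  polyHeight (intMinpoly α)

/-- `P` is an integer polynomial of degree at most `n` with
`H(P) ≤ X` and `0 < |P(ζ)| ≤ X ^ (-η)`. -/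
def IsPolySolution (n : ℕ) (ζ η X : ℝ) (P : ℤ[X]) : Prop :=
  P.natDegree ≤ n ∧ (polyHeight P : ℝ) ≤ X ∧ 0 < |aeval ζ P| ∧ |aeval ζ P| ≤ X ^ (-η)

/-- The exponent `w_n(ζ)`: the supremum (possibly `+∞`) of the real `η` for which there is a
solution for arbitrarily large `X`. -/
noncomputable def wExp (n : ℕ) (ζ : ℝ) : EReal :=
  sSup {x : EReal | ∃ η : ℝ, x = (η : EReal) ∧
    ∃ᶠ X : ℝ in atTop, ∃ P : ℤ[X], IsPolySolution n ζ η X P}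

/-- The uniform exponent `ŵ_n(ζ)`: the supremum (possibly `+∞`) of the real `η` for which there
is a solution for all sufficiently large `X`. -/
noncomputable def wHatExp (n : ℕ) (ζ : ℝ) : EReal :=
  sSup {x : EReal | ∃ η : ℝ, x = (η : EReal) ∧
    ∀ᶠ X : ℝ in atTop, ∃ P : ℤ[X], IsPolySolution n ζ η X P}

/-- The exponent `w*_n(ζ)`: the supremum (possibly `+∞`) of the real `η` for which
`0 < |ζ - α| ≤ H(α) ^ (-η - 1)` has infinitely many real algebraic solutions `α` of degree at
most `n`. -/
noncomputable def wStarExp (n : ℕ) (ζ : ℝ) : EReal :=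
  sSup {x : EReal | ∃ η : ℝ, x = (η : EReal) ∧
    {α : ℝ | IsAlgebraic ℚ α ∧ (minpoly ℚ α).natDegree ≤ n ∧
      0 < |ζ - α| ∧ |ζ - α| ≤ (algHeight α : ℝ) ^ (-η - 1)}.Infinite}

/-- The real algebraic integers `α` of degree exactly `d` with
`0 < |ζ - α| ≤ H(α) ^ (-η - 1)`. -/
def algIntSolutions (d : ℕ) (ζ η : ℝ) : Set ℝ :=
  {α : ℝ | IsIntegral ℤ α ∧ (minpoly ℚ α).natDegree = d ∧
    0 < |ζ - α| ∧ |ζ - α| ≤ (algHeight α : ℝ) ^ (-η - 1)}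

/-! The proof is a geometry-of-numbers argument made explicit. The Mahler measure `M` is comparable
to the height and multiplicative, so among the polynomials realising `w_m` there are irreducible `P`
of arbitrarily large `Y = M(P)` with `|P(ζ)| ≤ Y^(-θ)` (`frequently_irreducible`). The uniform
exponent, used at a scale slightly below `Y`, gives `Q` of degree at most `n` with `|Q(ζ)| ≤ Y^(-θ)`
and `M(Q) < Y`; hence `P ∤ Q`, and the two are coprime.

By coprimality every real `S` of degree less than `d = m + n` is `U P + V Q` with the degrees of `U`
and `V` controlled. Rounding the coefficients of `U` and `V` to integers gives an integer polynomial
`G` whose distance from `S` is `O(Y)` in the coefficients but only `O(Y^(-θ))` at `ζ`. Choosing `S`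
linear with slope a large multiple of `Y` makes `e X^d + p G` tiny at `ζ` with derivative at least
of order `pY` nearby, so it has a root `α` with `|ζ - α|` of order at most `Y^(-θ-1)`
(`exists_combination_root_near`).

For `e = 0` the degree is below `d`, which gives the first claim. For `e = 1` the polynomial is
Eisenstein at `p` provided `p ∤ G(0)`, so `α` is an algebraic integer of degree `d`. The rounding
can secure this if `p ∤ P(0)`, and such a prime exists with `p ≤ Y^ε`
(`eventually_exists_prime_not_dvd`), a negligible loss in height. The claims with `⌈n/2⌉` use `ŵ_k ≤
w_m` for `k ≤ m`. -/

/-! ### Mahler measure and heights -/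

/-- The Mahler measure of an integer polynomial. -/
noncomputable def intMahler (P : ℤ[X]) : ℝ :=
  (P.map (Int.castRingHom ℂ)).mahlerMeasure

lemma intMahler_mul (P Q : ℤ[X]) : intMahler (P * Q) = intMahler P * intMahler Q := by
  simp [intMahler, Polynomial.map_mul, mahlerMeasure_mul]

lemma one_le_intMahler {P : ℤ[X]} (hP : P ≠ 0) : 1 ≤ intMahler P :=
  one_le_mahlerMeasure_of_ne_zero hP

lemma intMahler_C (a : ℤ) : intMahler (C a) = |(a : ℝ)| := by
  rw [intMahler, map_C, mahlerMeasure_const, eq_intCast, Complex.norm_intCast]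

lemma intMahler_le_of_dvd {P Q : ℤ[X]} (hQ : Q ≠ 0) (h : P ∣ Q) :
    intMahler P ≤ intMahler Q := by
  obtain ⟨S, rfl⟩ := h
  rw [intMahler_mul]
  exact le_mul_of_one_le_right (mahlerMeasure_nonneg _)
    (one_le_intMahler (right_ne_zero_of_mul hQ))

lemma abs_coeff_le_polyHeight (P : ℤ[X]) (i : ℕ) : |(P.coeff i : ℝ)| ≤ polyHeight P := by
  by_cases hi : i ∈ P.support
  · have h : (P.coeff i).natAbs ≤ polyHeight P :=
      Finset.le_sup (f := fun i => (P.coeff i).natAbs) hi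
    rw [← Int.cast_abs, Int.abs_eq_natAbs]
    exact_mod_cast h
  · simp [notMem_support_iff.mp hi]

lemma polyHeight_le {P : ℤ[X]} {B : ℝ} (hB : 0 ≤ B) (h : ∀ i, |(P.coeff i : ℝ)| ≤ B) :
    (polyHeight P : ℝ) ≤ B := by
  refine (Nat.le_floor_iff hB).mp (Finset.sup_le fun i _ => (Nat.le_floor_iff hB).mpr ?_)
  rw [Nat.cast_natAbs, Int.cast_abs]
  exact h i

lemma one_le_polyHeight {P : ℤ[X]} (hP : P ≠ 0) : 1 ≤ polyHeight P := by
  refine le_trans ?_ (Finset.le_sup (f := fun i => (P.coeff i).natAbs)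
    (natDegree_mem_support_of_nonzero hP))
  exact Int.natAbs_pos.mpr (leadingCoeff_ne_zero.mpr hP)

lemma intMahler_le_polyHeight {n : ℕ} {P : ℤ[X]} (hP : P.natDegree ≤ n) :
    intMahler P ≤ (n + 1) * polyHeight P := by
  refine (mahlerMeasure_le_sum_norm_coeff _).trans ?_
  rw [sum_over_range' _ (by simp) (n + 1) (by grind [natDegree_map_le (f := Int.castRingHom ℂ) (p := P)])]
  calc _ ≤ ∑ _i ∈ Finset.range (n + 1), (polyHeight P : ℝ) :=
        Finset.sum_le_sum fun i _ => by simpa using abs_coeff_le_polyHeight P i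
    _ = _ := by simp

lemma polyHeight_le_intMahler {n : ℕ} {P : ℤ[X]} (hP : P.natDegree ≤ n) :
    (polyHeight P : ℝ) ≤ 2 ^ n * intMahler P := by
  have h0 : 0 ≤ intMahler P := mahlerMeasure_nonneg _
  refine polyHeight_le (by positivity) fun i => ?_
  have h := norm_coeff_le_choose_mul_mahlerMeasure i (P.map (Int.castRingHom ℂ))
  rw [coeff_map, eq_intCast, Complex.norm_intCast] at h
  refine h.trans ?_
  change _ * intMahler P ≤ _
  gcongr
  calc (((P.map (Int.castRingHom ℂ)).natDegree.choose i : ℕ) : ℝ)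
      ≤ (2 ^ (P.map (Int.castRingHom ℂ)).natDegree : ℕ) := by
        exact_mod_cast Nat.choose_le_two_pow _ _
    _ ≤ 2 ^ n := by
        push_cast
        exact pow_le_pow_right₀ (by norm_num) (natDegree_map_le.trans hP)

/-- Gauss's lemma: divisibility over `ℚ` by a primitive polynomial descends to `ℤ`. -/
lemma intMinpoly_dvd {α : ℝ} {R : ℤ[X]} (hα : IsAlgebraic ℚ α) (hR : aeval α R = 0) :
    intMinpoly α ∣ R := by
  set N := IsLocalization.integerNormalization (nonZeroDivisors ℤ) (minpoly ℚ α) with hN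
  have hm : minpoly ℚ α ≠ 0 := minpoly.ne_zero hα.isIntegral
  have hmR : minpoly ℚ α ∣ R.map (algebraMap ℤ ℚ) :=
    minpoly.dvd _ _ (by rwa [aeval_map_algebraMap])
  refine (isPrimitive_primPart N).dvd_of_fraction_map_dvd_fraction_map (K := ℚ) ?_
  refine dvd_trans ?_ hmR
  obtain ⟨b, hb0, hb⟩ :=
    IsLocalization.integerNormalization_spec (nonZeroDivisors ℤ) (minpoly ℚ α)
  refine (map_dvd (mapRingHom (algebraMap ℤ ℚ)) (primPart_dvd N)).trans ?_
  rw [coe_mapRingHom, hb]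
  have hb0 : (b : ℚ) ≠ 0 := by exact_mod_cast nonZeroDivisors.ne_zero hb0
  refine ⟨C (b : ℚ)⁻¹, ?_⟩
  ext i
  simp [mul_comm, hb0]

lemma one_le_algHeight (α : ℝ) : 1 ≤ algHeight α :=
  one_le_polyHeight (primPart_ne_zero _)

/-- The height is not monotone under divisibility, but the Mahler measure is; passing through it
costs only a constant depending on `n`. -/
lemma algHeight_le {n : ℕ} {α : ℝ} {R : ℤ[X]} (hR : R ≠ 0) (hn : R.natDegree ≤ n)
    (hα : aeval α R = 0) :
    (algHeight α : ℝ) ≤ 2 ^ n * ((n + 1) * polyHeight R) := by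
  have halg : IsAlgebraic ℚ α := (IsAlgebraic.extendScalars (R := ℤ)
    (algebraMap ℤ ℚ).injective_int ⟨R, hR, hα⟩)
  have hd := intMinpoly_dvd halg hα
  calc (algHeight α : ℝ) ≤ 2 ^ n * intMahler (intMinpoly α) :=
        polyHeight_le_intMahler ((natDegree_le_of_dvd hd hR).trans hn)
    _ ≤ 2 ^ n * intMahler R := by gcongr; exact intMahler_le_of_dvd hR hd
    _ ≤ _ := by gcongr; exact intMahler_le_polyHeight hn

lemma minpoly_natDegree_le {α : ℝ} {R : ℤ[X]} (hR : R ≠ 0) (hα : aeval α R = 0) :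
    (minpoly ℚ α).natDegree ≤ R.natDegree := by
  have h0 : R.map (algebraMap ℤ ℚ) ≠ 0 :=
    (Polynomial.map_ne_zero_iff (algebraMap ℤ ℚ).injective_int).mpr hR
  exact (natDegree_le_of_dvd (minpoly.dvd ℚ α (by rwa [aeval_map_algebraMap])) h0).trans
    natDegree_map_le

lemma aeval_ne_zero_of_transcendental {ζ : ℝ} (hζ : Transcendental ℚ ζ) {P : ℤ[X]} (hP : P ≠ 0) :
    aeval ζ P ≠ 0 := fun h =>
  hζ (IsAlgebraic.extendScalars (R := ℤ) (algebraMap ℤ ℚ).injective_int ⟨P, hP, h⟩)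

/-! ### Irreducible polynomials with small value at `ζ` -/

/-- If no irreducible polynomial of degree at most `n` and large Mahler measure satisfies
`|P(ζ)| ≤ M(P) ^ (-η)`, then `|P(ζ)|` is bounded below by a multiple of `M(P) ^ (-η)` for all
nonzero `P` of degree at most `n`. -/
lemma exists_lower_bound {ζ η : ℝ} (hζ : Transcendental ℚ ζ) (hη : 0 ≤ η) (n : ℕ) (Y : ℝ)
    (h : ∀ P : ℤ[X], Irreducible P → P.natDegree ≤ n → Y ≤ intMahler P →
      intMahler P ^ (-η) < |aeval ζ P|) :
    ∃ c : ℝ, 0 < c ∧ ∀ P : ℤ[X], P ≠ 0 → P.natDegree ≤ n →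
      c * intMahler P ^ (-η) ≤ |aeval ζ P| := by
  obtain ⟨c, hc0, hc1, hc⟩ : ∃ c : ℝ, 0 < c ∧ c ≤ 1 ∧ ∀ P : ℤ[X], Irreducible P →
      P.natDegree ≤ n → c * intMahler P ^ (-η) ≤ |aeval ζ P| := by
    -- Northcott: only finitely many polynomials fall below the threshold `Y`, so their nonzero
    -- values at `ζ` have a positive minimum.
    have hfin := finite_mahlerMeasure_le n Y.toNNReal
    obtain ⟨c, hc0, hc1, hc⟩ : ∃ c : ℝ, 0 < c ∧ c ≤ 1 ∧ ∀ P ∈ {p : ℤ[X] | p.natDegree ≤ n ∧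
        (p.map (Int.castRingHom ℂ)).mahlerMeasure ≤ Y.toNNReal}, P ≠ 0 → c ≤ |aeval ζ P| := by
      generalize {p : ℤ[X] | p.natDegree ≤ n ∧
        (p.map (Int.castRingHom ℂ)).mahlerMeasure ≤ Y.toNNReal} = S at hfin
      induction S, hfin using Set.Finite.induction_on with
      | empty => exact ⟨1, one_pos, le_rfl, by simp⟩
      | @insert a s _ _ ih =>
        obtain ⟨c, hc0, hc1, hc⟩ := ih
        by_cases ha : a = 0
        · exact ⟨c, hc0, hc1, by grind⟩
        · have := abs_pos.mpr (aeval_ne_zero_of_transcendental hζ ha)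
          exact ⟨min c |aeval ζ a|, lt_min hc0 this, (min_le_left _ _).trans hc1, by grind⟩
    refine ⟨c, hc0, hc1, fun P hP hn => ?_⟩
    have hM := one_le_intMahler hP.ne_zero
    have hM0 : 0 ≤ intMahler P ^ (-η) := by positivity
    rcases le_or_gt Y (intMahler P) with hY | hY
    · exact (mul_le_of_le_one_left hM0 hc1).trans (h P hP hn hY).le
    · refine le_trans ?_ (hc P ⟨hn, hY.le.trans (Real.le_coe_toNNReal Y)⟩ hP.ne_zero)
      exact mul_le_of_le_one_right hc0.le
        (Real.rpow_le_one_of_one_le_of_nonpos hM (by linarith))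
  have key : ∀ P : ℤ[X], P ≠ 0 → P.natDegree ≤ n →
      c ^ P.natDegree * intMahler P ^ (-η) ≤ |aeval ζ P| := by
    intro P
    induction P using WfDvdMonoid.induction_on_irreducible with
    | zero => simp
    | unit u hu =>
      intro _ _
      obtain ⟨a, ha, rfl⟩ := Polynomial.isUnit_iff.mp hu
      rcases Int.isUnit_iff.mp ha with rfl | rfl <;> rw [intMahler_C] <;> simp
    | mul a i ha hi ih =>
      intro hia hn
      have hi0 := hi.ne_zero
      rw [natDegree_mul hi0 ha] at hn ⊢
      have h1 := ih ha (by omega)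
      have h2 : c ^ i.natDegree * intMahler i ^ (-η) ≤ |aeval ζ i| := by
        have hM := one_le_intMahler hi0
        -- Constant prime factors must cost no factor `c`, as their number is not bounded by the
        -- degree; for them `|b| ≥ 1 ≥ M^(-η)`.
        rcases Nat.eq_zero_or_pos i.natDegree with h0 | h0
        · obtain ⟨b, rfl⟩ := natDegree_eq_zero.mp h0
          rw [h0, pow_zero, one_mul]
          refine (Real.rpow_le_one_of_one_le_of_nonpos hM (by linarith)).trans ?_
          rw [intMahler_C] at hM
          simpa using hM
        · refine le_trans ?_ (hc i hi (by omega))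
          gcongr
          exact pow_le_of_le_one hc0.le hc1 h0.ne'
      have := one_le_intMahler hi0
      have := one_le_intMahler ha
      rw [intMahler_mul, map_mul, abs_mul, Real.mul_rpow (by linarith) (by linarith), pow_add]
      calc _ = (c ^ i.natDegree * intMahler i ^ (-η)) * (c ^ a.natDegree * intMahler a ^ (-η)) := by
            ring
        _ ≤ _ := by gcongr
  refine ⟨c ^ n, by positivity, fun P hP hn => le_trans ?_ (key P hP hn)⟩
  have := one_le_intMahler hP
  exact mul_le_mul_of_nonneg_right (pow_le_pow_of_le_one hc0.le hc1 hn) (by positivity)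

/-- Otherwise `exists_lower_bound` would bound `|P(ζ)|` below by a multiple of `X^(-η)` for all `P`
of height at most `X`, against `X^(-η')` for large `X`. -/
lemma frequently_irreducible {ζ η η' : ℝ} (hζ : Transcendental ℚ ζ) (hη : 0 ≤ η) (hηη' : η < η')
    (n : ℕ) (h : ∃ᶠ X : ℝ in atTop, ∃ P : ℤ[X], IsPolySolution n ζ η' X P) (Y : ℝ) :
    ∃ P : ℤ[X], Irreducible P ∧ P.natDegree ≤ n ∧ Y ≤ intMahler P ∧
      |aeval ζ P| ≤ intMahler P ^ (-η) := by
  by_contra! hcon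
  obtain ⟨c, hc0, hc⟩ := exists_lower_bound hζ hη n Y hcon
  have hlim : Tendsto (fun X : ℝ => X ^ (-(η' - η))) atTop (nhds 0) :=
    tendsto_rpow_neg_atTop (by linarith)
  have hpos : 0 < c * (n + 1 : ℝ) ^ (-η) := by positivity
  obtain ⟨X, ⟨P, hn, hH, hP0, hP⟩, hX0, hX⟩ :=
    (h.and_eventually ((eventually_gt_atTop 0).and (hlim.eventually (gt_mem_nhds hpos)))).exists
  have hPne : P ≠ 0 := by rintro rfl; simp at hP0
  have hM := one_le_intMahler hPne
  have hMX : intMahler P ≤ (n + 1) * X :=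
    (intMahler_le_polyHeight hn).trans (by gcongr)
  have h1 : c * ((n + 1) * X) ^ (-η) ≤ X ^ (-η') := by
    refine le_trans ?_ ((hc P hPne hn).trans hP)
    exact mul_le_mul_of_nonneg_left
      (Real.rpow_le_rpow_of_nonpos (by linarith) hMX (by linarith)) hc0.le
  rw [Real.mul_rpow (by positivity) hX0.le, show -η' = -(η' - η) + -η by ring,
    Real.rpow_add hX0, ← mul_assoc] at h1
  have h2 : 0 < X ^ (-η) := by positivity
  exact absurd (le_of_mul_le_mul_right h1 h2) (not_le.mpr hX)

/-! ### Root location and coefficient estimates -/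

lemma exists_root_near {F : ℝ[X]} {ζ κ δ : ℝ} (hκ : 0 < κ)
    (hF : ∀ t, |t - ζ| ≤ 1 → κ ≤ F.derivative.eval t) (hδ : δ ≤ 1) (h0 : |F.eval ζ| ≤ κ * δ) :
    ∃ α, F.eval α = 0 ∧ |ζ - α| ≤ δ := by
  have hδ0 : 0 ≤ δ := nonneg_of_mul_nonneg_right ((abs_nonneg _).trans h0) hκ
  have mvt : ∀ x ∈ Set.Icc (ζ - 1) (ζ + 1), ∀ y ∈ Set.Icc (ζ - 1) (ζ + 1), x ≤ y →
      κ * (y - x) ≤ F.eval y - F.eval x := by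
    refine (convex_Icc (ζ - 1) (ζ + 1)).mul_sub_le_image_sub_of_le_deriv
      F.continuous.continuousOn F.differentiable.differentiableOn fun t ht => ?_
    rw [Polynomial.deriv]
    have := interior_subset ht
    exact hF t (abs_le.mpr ⟨by linarith [this.1], by linarith [this.2]⟩)
  have h1 := mvt (ζ - δ) ⟨by linarith, by linarith⟩ ζ ⟨by linarith, by linarith⟩ (by linarith)
  have h2 := mvt ζ ⟨by linarith, by linarith⟩ (ζ + δ) ⟨by linarith, by linarith⟩ (by linarith)
  have h3 := abs_le.mp h0
  obtain ⟨α, hα, hα0⟩ := intermediate_value_Icc (show ζ - δ ≤ ζ + δ by linarith)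
    F.continuous.continuousOn
    (show (0 : ℝ) ∈ Set.Icc (F.eval (ζ - δ)) (F.eval (ζ + δ)) from
      ⟨by linarith, by linarith⟩)
  exact ⟨α, hα0, abs_le.mpr ⟨by linarith [hα.2], by linarith [hα.1]⟩⟩

lemma abs_eval_le {A : ℝ[X]} {d : ℕ} {B r t : ℝ} (hA : A.natDegree < d)
    (hB : ∀ i, |A.coeff i| ≤ B) (hr : 1 ≤ r) (ht : |t| ≤ r) :
    |A.eval t| ≤ B * (d * r ^ d) := by
  rw [eval_eq_sum_range' hA]
  have hB0 : 0 ≤ B := (abs_nonneg _).trans (hB 0)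
  calc _ ≤ ∑ i ∈ Finset.range d, |A.coeff i * t ^ i| := Finset.abs_sum_le_sum_abs _ _
    _ ≤ ∑ _i ∈ Finset.range d, B * r ^ d := by
        refine Finset.sum_le_sum fun i hi => ?_
        rw [abs_mul, abs_pow]
        have : |t| ^ i ≤ r ^ d := (pow_le_pow_left₀ (abs_nonneg t) ht i).trans
          (pow_le_pow_right₀ hr (Finset.mem_range.mp hi).le)
        exact mul_le_mul (hB i) this (by positivity) hB0
    _ = _ := by simp; ring

lemma abs_eval_derivative_le {A : ℝ[X]} {d : ℕ} {B r t : ℝ} (hA : A.natDegree < d)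
    (hB : ∀ i, |A.coeff i| ≤ B) (hr : 1 ≤ r) (ht : |t| ≤ r) :
    |A.derivative.eval t| ≤ (B * d) * (d * r ^ d) := by
  have hB0 : 0 ≤ B := (abs_nonneg _).trans (hB 0)
  refine abs_eval_le ((natDegree_derivative_le A).trans_lt (by omega)) (fun i => ?_) hr ht
  rw [coeff_derivative, abs_mul]
  by_cases hi : i + 1 < d
  · have h : |(i : ℝ) + 1| ≤ d := by
      rw [abs_of_nonneg (by positivity)]
      exact_mod_cast hi.le
    exact mul_le_mul (hB _) h (abs_nonneg _) hB0
  · rw [coeff_eq_zero_of_natDegree_lt (by omega)]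
    simp
    positivity

lemma abs_coeff_mul_le {A P : ℝ[X]} {B H : ℝ} (hA : ∀ i, |A.coeff i| ≤ B)
    (hP : ∀ i, |P.coeff i| ≤ H) (k : ℕ) : |(A * P).coeff k| ≤ (k + 1) * (B * H) := by
  have hB0 : 0 ≤ B := (abs_nonneg _).trans (hA 0)
  rw [coeff_mul]
  calc _ ≤ ∑ x ∈ Finset.HasAntidiagonal.antidiagonal k, |A.coeff x.1 * P.coeff x.2| :=
        Finset.abs_sum_le_sum_abs _ _
    _ ≤ ∑ _x ∈ Finset.HasAntidiagonal.antidiagonal k, B * H := by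
        refine Finset.sum_le_sum fun x _ => ?_
        rw [abs_mul]
        exact mul_le_mul (hA _) (hP _) (abs_nonneg _) hB0
    _ = _ := by simp

/-! ### Integer combinations of two coprime polynomials -/

/-- Rounding of a real polynomial with a prescribed constant term. -/
lemma exists_int_round {U : ℝ[X]} {k : ℕ} (hU : U.natDegree < k) {a : ℤ}
    (ha : |(a : ℝ) - U.coeff 0| ≤ 1) :
    ∃ W : ℤ[X], W.natDegree < k ∧ W.coeff 0 = a ∧ ∀ i, |(W.coeff i : ℝ) - U.coeff i| ≤ 1 := by
  let f : ℕ → ℤ := fun i => if i = 0 then a else ⌊U.coeff i⌋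
  let W : ℤ[X] := ∑ i ∈ Finset.range k, monomial i (f i)
  have hW : ∀ i, W.coeff i = if i < k then f i else 0 := by
    intro i
    simp [W, coeff_monomial]
  refine ⟨W, ?_, by grind, fun i => ?_⟩
  · have : W.natDegree ≤ k - 1 := natDegree_le_iff_coeff_eq_zero.mpr fun i hi => by grind
    omega
  · rw [hW]
    split_ifs with hi
    · by_cases h0 : i = 0
      · simpa [f, h0] using ha
      · simp only [f, h0, if_false]
        rw [abs_le]
        constructor <;> linarith [Int.floor_le (U.coeff i), Int.lt_floor_add_one (U.coeff i)]
    · rw [coeff_eq_zero_of_natDegree_lt (by omega)]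
      simp

lemma exists_real_combination {P Q : ℤ[X]} {m n : ℕ} (hP : Irreducible P)
    (hP0 : 0 < P.natDegree) (hPm : P.natDegree ≤ m) (hQn : Q.natDegree ≤ n) (hn : 1 ≤ n)
    (hPQ : ¬ P ∣ Q) (S : ℝ[X]) (hS : S.natDegree < m + n) :
    ∃ U V : ℝ[X], U.natDegree < m + n - P.natDegree ∧ V.natDegree < P.natDegree ∧
      S = U * P.map (Int.castRingHom ℝ) + V * Q.map (Int.castRingHom ℝ) := by
  have hprim : P.IsPrimitive := hP.isPrimitive hP0.ne'
  have hPQ' : IsCoprime (P.map (Int.castRingHom ℚ)) (Q.map (Int.castRingHom ℚ)) := by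
    refine ((IsPrimitive.Int.irreducible_iff_irreducible_map_cast hprim).mp hP).coprime_iff_not_dvd.mpr ?_
    rwa [← IsPrimitive.Int.dvd_iff_map_cast_dvd_map_cast P Q hprim]
  have hcop : IsCoprime (P.map (Int.castRingHom ℝ)) (Q.map (Int.castRingHom ℝ)) := by
    have := hPQ'.map (mapRingHom (algebraMap ℚ ℝ))
    rw [coe_mapRingHom, Polynomial.map_map, Polynomial.map_map] at this
    rwa [RingHom.ext_int (Int.castRingHom ℝ) ((algebraMap ℚ ℝ).comp (Int.castRingHom ℚ))]
  set p := P.map (Int.castRingHom ℝ) with hp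
  set q := Q.map (Int.castRingHom ℝ) with hq
  have hpd : p.natDegree = P.natDegree := natDegree_map_eq_of_injective Int.cast_injective P
  have hqd : q.natDegree ≤ n := natDegree_map_le.trans hQn
  have hp0 : p ≠ 0 := by rintro h; rw [h] at hpd; simp at hpd; omega
  obtain ⟨a, b, hab⟩ := hcop
  -- Reducing the Bézout multiplier of `q` modulo `p` bounds the degree of `V`; that of `U` then
  -- follows by comparing degrees in `p U = S - V q`.
  let V := (S * b) % p
  have hV : V.natDegree < P.natDegree := by
    rw [← hpd]
    exact natDegree_mod_lt _ (by omega)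
  obtain ⟨U, hU⟩ : p ∣ S - V * q := by
    have h1 : S * b = p * (S * b / p) + V := (EuclideanDomain.div_add_mod _ _).symm
    refine ⟨S * a + (S * b / p) * q, ?_⟩
    have : S = S * (a * p) + (S * b) * q := by linear_combination -S * hab
    linear_combination this + q * h1
  refine ⟨U, V, ?_, hV, by linear_combination hU⟩
  by_cases hU0 : U = 0
  · simp [hU0]; omega
  have h2 : (p * U).natDegree < m + n := by
    rw [← hU]
    refine (natDegree_sub_le _ _).trans_lt (max_lt hS (natDegree_mul_le.trans_lt (by omega)))
  rw [natDegree_mul hp0 hU0] at h2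
  omega

lemma exists_int_combination {P Q : ℤ[X]} {m n : ℕ} (hP : Irreducible P)
    (hP0 : 0 < P.natDegree) (hPm : P.natDegree ≤ m) (hQn : Q.natDegree ≤ n) (hn : 1 ≤ n)
    (hPQ : ¬ P ∣ Q) {p : ℤ} (hpP : ¬ p ∣ P.coeff 0)
    (S : ℝ[X]) (hS : S.natDegree < m + n) :
    ∃ (G : ℤ[X]) (A B : ℝ[X]), G.natDegree < m + n ∧ ¬ p ∣ G.coeff 0 ∧
      A.natDegree < m + n ∧ B.natDegree < m + n ∧
      (∀ i, |A.coeff i| ≤ 1) ∧ (∀ i, |B.coeff i| ≤ 1) ∧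
      G.map (Int.castRingHom ℝ) =
        S + (A * P.map (Int.castRingHom ℝ) + B * Q.map (Int.castRingHom ℝ)) := by
  obtain ⟨U, V, hU, hV, hS'⟩ := exists_real_combination hP hP0 hPm hQn hn hPQ S hS
  have fl : ∀ x : ℝ, |(⌊x⌋ : ℝ) - x| ≤ 1 := fun x => by
    rw [abs_le]
    constructor <;> linarith [Int.floor_le x, Int.lt_floor_add_one x]
  have fl' : ∀ x : ℝ, |((⌊x⌋ + 1 : ℤ) : ℝ) - x| ≤ 1 := fun x => by
    push_cast
    rw [abs_le]
    constructor <;> linarith [Int.floor_le x, Int.lt_floor_add_one x]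
  obtain ⟨W, hW, -, hWV⟩ := exists_int_round hV (fl (V.coeff 0))
  obtain ⟨a, ha, hpa⟩ : ∃ a : ℤ, |(a : ℝ) - U.coeff 0| ≤ 1 ∧
      ¬ p ∣ a * P.coeff 0 + W.coeff 0 * Q.coeff 0 := by
    -- Raising the constant coefficient of the rounded `U` by one changes `G(0)` by `P(0)`, which
    -- `p` does not divide, so the floor or its successor works.
    by_cases h : p ∣ ⌊U.coeff 0⌋ * P.coeff 0 + W.coeff 0 * Q.coeff 0
    · refine ⟨_, fl' _, fun h' => hpP ?_⟩
      have := dvd_sub h' h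
      rwa [show (⌊U.coeff 0⌋ + 1) * P.coeff 0 + W.coeff 0 * Q.coeff 0 -
        (⌊U.coeff 0⌋ * P.coeff 0 + W.coeff 0 * Q.coeff 0) = P.coeff 0 by ring] at this
    · exact ⟨_, fl _, h⟩
  obtain ⟨Z, hZ, hZ0, hZU⟩ := exists_int_round hU ha
  refine ⟨Z * P + W * Q, Z.map (Int.castRingHom ℝ) - U, W.map (Int.castRingHom ℝ) - V,
    ?_, ?_, ?_, ?_, ?_, ?_, ?_⟩
  · refine (natDegree_add_le _ _).trans_lt (max_lt ?_ ?_) <;>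
      refine natDegree_mul_le.trans_lt ?_ <;> omega
  · simpa [mul_coeff_zero, hZ0] using hpa
  · exact (natDegree_sub_le _ _).trans_lt (max_lt (natDegree_map_le.trans_lt (by omega)) (by omega))
  · exact (natDegree_sub_le _ _).trans_lt (max_lt (natDegree_map_le.trans_lt (by omega)) (by omega))
  · simpa using hZU
  · simpa using hWV
  · rw [Polynomial.map_add, Polynomial.map_mul, Polynomial.map_mul]
    linear_combination -hS'

set_option maxHeartbeats 1000000 in
/-- Two small values of polynomials `P ∤ Q` at `ζ`, with `P` irreducible, yield a polynomial
`e X ^ (m + n) + p G` with a root very close to `ζ`. -/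
lemma exists_combination_root_near (ζ : ℝ) {m n : ℕ} (hm : 1 ≤ m) (hn : 1 ≤ n) :
    ∃ K : ℝ, 1 ≤ K ∧ ∀ (P Q : ℤ[X]) (p : ℕ) (H v : ℝ) (e : ℤ), Irreducible P →
      0 < P.natDegree → P.natDegree ≤ m → Q.natDegree ≤ n → ¬ P ∣ Q → 1 ≤ p →
      ¬ (p : ℤ) ∣ P.coeff 0 → polyHeight P ≤ H → polyHeight Q ≤ H → |aeval ζ P| ≤ v →
      |aeval ζ Q| ≤ v → 1 ≤ H → K * v / H ≤ 1 → (e = 0 ∨ e = 1) →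
      ∃ G : ℤ[X], G.natDegree < m + n ∧ ¬ (p : ℤ) ∣ G.coeff 0 ∧
        C e * X ^ (m + n) + C (p : ℤ) * G ≠ 0 ∧
        (polyHeight (C e * X ^ (m + n) + C (p : ℤ) * G) : ℝ) ≤ K * (p * H) ∧
        ∃ α : ℝ, aeval α (C e * X ^ (m + n) + C (p : ℤ) * G) = 0 ∧ |ζ - α| ≤ K * v / H := by
  set d := m + n with hd
  have hd2 : 2 ≤ d := by omega
  set r : ℝ := |ζ| + 1 with hr
  have hr1 : 1 ≤ r := by have := abs_nonneg ζ; linarith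
  set s : ℝ := d * r ^ d with hs
  have hdR : (2 : ℝ) ≤ d := by exact_mod_cast hd2
  have hrd : 1 ≤ r ^ d := one_le_pow₀ hr1
  have hs1 : 1 ≤ s := by nlinarith
  -- The slope has to beat the derivative of the rounding error, at most `2 d² s H`, and that of `e
  -- X^d`, at most `s`, and still leave `p H`.
  set L : ℝ := 2 * d * d * s + s + 1 with hL
  have hL0 : 0 < L := by positivity
  have hLr : 0 < L * r := by positivity
  refine ⟨1 + L * r + s + 2 * d + 2 * s, by linarith, ?_⟩
  set K := 1 + L * r + s + 2 * d + 2 * s with hK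
  intro P Q p H v e hP hP0 hPm hQn hPQ hp hpP hPH hQH hPv hQv hH hKv he
  have hv : 0 ≤ v := (abs_nonneg _).trans hPv
  have hp1 : (1 : ℝ) ≤ p := by exact_mod_cast hp
  have hpH : 1 ≤ (p : ℝ) * H := by nlinarith
  have he1 : |(e : ℝ)| ≤ 1 := by rcases he with rfl | rfl <;> simp
  -- The constant `-e ζ^d / p` cancels `e X^d` at `ζ`, leaving only `p` times the rounding error
  -- there.
  set S : ℝ[X] := C (L * H) * (X - C ζ) - C (e * ζ ^ d / p) with hS
  have hSd : S.natDegree < d := by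
    refine (natDegree_sub_le _ _).trans_lt (max_lt ?_ ?_)
    · exact (natDegree_C_mul_le _ _).trans_lt (by rw [natDegree_X_sub_C]; omega)
    · rw [natDegree_C]; omega
  obtain ⟨G, A, B, hG, hpG, hAd, hBd, hA, hB, hGS⟩ :=
    exists_int_combination hP hP0 hPm hQn hn hPQ hpP S hSd
  set D := A * P.map (Int.castRingHom ℝ) + B * Q.map (Int.castRingHom ℝ) with hD
  have hDd : D.natDegree < d := by
    have : D = G.map (Int.castRingHom ℝ) - S := by rw [hGS]; ring
    rw [this]
    exact (natDegree_sub_le _ _).trans_lt (max_lt (natDegree_map_le.trans_lt hG) hSd)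
  have hDc : ∀ k, |D.coeff k| ≤ 2 * d * H := by
    intro k
    by_cases hk : k < d
    · have hk' : (k : ℝ) + 1 ≤ d := by exact_mod_cast hk
      have hA' := abs_coeff_mul_le hA (P := P.map (Int.castRingHom ℝ)) (H := H)
        (fun i => by simpa using (abs_coeff_le_polyHeight P i).trans hPH) k
      have hB' := abs_coeff_mul_le hB (P := Q.map (Int.castRingHom ℝ)) (H := H)
        (fun i => by simpa using (abs_coeff_le_polyHeight Q i).trans hQH) k
      rw [hD, coeff_add]
      have := abs_add_le ((A * P.map (Int.castRingHom ℝ)).coeff k)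
        ((B * Q.map (Int.castRingHom ℝ)).coeff k)
      nlinarith
    · rw [coeff_eq_zero_of_natDegree_lt (by omega), abs_zero]
      positivity
  have hDζ : |D.eval ζ| ≤ 2 * s * v := by
    have hA' := abs_eval_le hAd hA hr1 (t := ζ) (by linarith)
    have hB' := abs_eval_le hBd hB hr1 (t := ζ) (by linarith)
    rw [one_mul] at hA' hB'
    have hPe : (P.map (Int.castRingHom ℝ)).eval ζ = aeval ζ P := by
      rw [aeval_def, eval_map]; rfl
    have hQe : (Q.map (Int.castRingHom ℝ)).eval ζ = aeval ζ Q := by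
      rw [aeval_def, eval_map]; rfl
    rw [hD, eval_add, eval_mul, eval_mul, hPe, hQe]
    calc _ ≤ |A.eval ζ * aeval ζ P| + |B.eval ζ * aeval ζ Q| := abs_add_le _ _
      _ ≤ s * v + s * v := by
          rw [abs_mul, abs_mul]
          gcongr
      _ = _ := by ring
  set R : ℤ[X] := C e * X ^ d + C (p : ℤ) * G with hR
  have hRmap : R.map (Int.castRingHom ℝ) = C (e : ℝ) * X ^ d + C (p : ℝ) * (S + D) := by
    rw [hR, Polynomial.map_add, Polynomial.map_mul, Polynomial.map_mul, hGS]
    simp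
  have hev : ∀ t, (R.map (Int.castRingHom ℝ)).eval t = aeval t R := fun t => by
    rw [aeval_def, eval_map]; rfl
  have hRζ : |(R.map (Int.castRingHom ℝ)).eval ζ| ≤ (p * H) * (2 * s * v / H) := by
    have : (R.map (Int.castRingHom ℝ)).eval ζ = p * D.eval ζ := by
      rw [hRmap, hS]
      simp
      field_simp
      ring
    rw [this, abs_mul, abs_of_nonneg (by positivity)]
    calc (p : ℝ) * |D.eval ζ| ≤ p * (2 * s * v) := by gcongr
      _ = _ := by field_simp
  have hRder : ∀ t, |t - ζ| ≤ 1 → p * H ≤ (R.map (Int.castRingHom ℝ)).derivative.eval t := by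
    intro t ht
    have htr : |t| ≤ r := by
      have := abs_add_le (t - ζ) ζ
      rw [sub_add_cancel] at this
      linarith
    have h1 := abs_eval_derivative_le hDd hDc hr1 htr
    have h2 : |(e : ℝ) * (d * t ^ (d - 1))| ≤ s := by
      rw [abs_mul, abs_mul, abs_pow, Nat.abs_cast]
      calc |(e : ℝ)| * (d * |t| ^ (d - 1)) ≤ 1 * (d * |t| ^ (d - 1)) := by gcongr
        _ ≤ d * r ^ (d - 1) := by rw [one_mul]; gcongr
        _ ≤ s := by rw [hs]; gcongr; exacts [by omega]
    have h3 : (R.map (Int.castRingHom ℝ)).derivative.eval t =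
        e * (d * t ^ (d - 1)) + p * (L * H + D.derivative.eval t) := by
      rw [hRmap, hS]
      simp [derivative_X_pow]
    rw [h3]
    have h4 := (abs_le.mp h1).1
    have h5 := (abs_le.mp h2).1
    have h6 : H * (s + 1) ≤ L * H + D.derivative.eval t := by
      have : L * H = 2 * d * H * d * s + H * (s + 1) := by rw [hL]; ring
      linarith
    have h7 : p * (H * (s + 1)) ≤ p * (L * H + D.derivative.eval t) := by gcongr
    have h8 : 0 ≤ s * (p * H - 1) := mul_nonneg (by linarith) (by linarith)
    linarith
  have hle : 2 * s * v / H ≤ K * v / H := by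
    gcongr
    linarith
  obtain ⟨α, hα0, hα⟩ := exists_root_near (by positivity) hRder (hle.trans hKv) hRζ
  refine ⟨G, hG, hpG, ?_, ?_, α, by rw [← hev]; exact hα0, hα.trans hle⟩
  · intro h0
    change R = 0 at h0
    have := hRder ζ (by simp)
    rw [h0] at this
    simp at this
    linarith
  · refine polyHeight_le (by positivity) fun k => ?_
    have hc : (R.coeff k : ℝ) = (C (e : ℝ) * X ^ d + C (p : ℝ) * (S + D)).coeff k := by
      rw [← hRmap]; simp
    have hX : |(X - C ζ : ℝ[X]).coeff k| ≤ r := by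
      rw [coeff_sub, coeff_X, coeff_C]
      rcases k with _ | _ | k
      · simp; linarith
      · simp; exact hr1
      · simp; linarith
    have hζd : |(C (e * ζ ^ d / p : ℝ)).coeff k| ≤ s := by
      rw [coeff_C]
      split_ifs with hk
      · rw [abs_div, abs_mul, abs_pow, Nat.abs_cast]
        calc |(e : ℝ)| * |ζ| ^ d / p ≤ 1 * r ^ d / 1 := by
              gcongr
              linarith
          _ ≤ s := by rw [one_mul, div_one]; nlinarith
      · simp; linarith
    have hSk : |S.coeff k| ≤ L * H * r + s := by
      rw [hS, coeff_sub, coeff_C_mul]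
      refine (abs_sub _ _).trans ?_
      rw [abs_mul, abs_of_nonneg (by positivity : 0 ≤ L * H)]
      exact add_le_add (mul_le_mul_of_nonneg_left hX (by positivity)) hζd
    have hek : |(C (e : ℝ) * X ^ d : ℝ[X]).coeff k| ≤ 1 := by
      rw [coeff_C_mul, coeff_X_pow]
      split_ifs
      · simpa using he1
      · simp
    rw [hc, coeff_add, coeff_C_mul (S + D), coeff_add]
    calc _ ≤ |(C (e : ℝ) * X ^ d : ℝ[X]).coeff k| + |(p : ℝ) * (S.coeff k + D.coeff k)| :=
          abs_add_le _ _
      _ ≤ 1 + p * ((L * H * r + s) + 2 * d * H) := by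
          rw [abs_mul, Nat.abs_cast]
          gcongr
          exact (abs_add_le _ _).trans (add_le_add hSk (hDc k))
      _ ≤ p * H + p * ((L * H * r + s * H) + 2 * d * H) := by
          gcongr
          nlinarith
      _ ≤ K * (p * H) := by
          have : 0 ≤ 2 * s * (p * H) := by positivity
          rw [hK]
          linarith

/-! ### Small primes avoiding a given integer -/

lemma sq_le_theta {y : ℝ} (hy : 100 ≤ y) : y ^ 2 ≤ Chebyshev.theta (y ^ 4) := by
  have h := Chebyshev.theta_ge' (x := y ^ 4) (one_le_pow₀ (by linarith))
  have hlog : Real.log y ≤ y := (Real.log_le_sub_one_of_pos (by linarith)).trans (by linarith)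
  have h1 : Real.log (y ^ 4) ≤ 4 * y := by
    rw [Real.log_pow]
    push_cast
    linarith
  have h2 : Real.log (y ^ 4 + 2) ≤ 5 * y := by
    have h3 : y ^ 4 + 2 ≤ y ^ 5 := by
      have : 1 ≤ y ^ 4 := one_le_pow₀ (by linarith)
      nlinarith
    refine (Real.log_le_log (by positivity) h3).trans ?_
    rw [Real.log_pow]
    push_cast
    linarith
  have h4 : √(y ^ 4) = y ^ 2 := by
    rw [show y ^ 4 = (y ^ 2) ^ 2 by ring, Real.sqrt_sq (by positivity)]
  rw [h4] at h
  have h5 : 2 * y ^ 2 * Real.log (y ^ 4) ≤ 2 * y ^ 2 * (4 * y) := by gcongr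
  have h6 : (y ^ 4 - 1) * (1 / 2) ≤ (y ^ 4 - 1) * Real.log 2 := by
    have : 1 ≤ y ^ 4 := one_le_pow₀ (by linarith)
    exact mul_le_mul_of_nonneg_left (by linarith [Real.log_two_gt_d9]) (by linarith)
  have h7 : 100 * y ^ 3 ≤ y ^ 4 := by
    nlinarith [pow_pos (show 0 < y by linarith) 3]
  have h8 : 100 * y ^ 2 ≤ y ^ 3 := by
    nlinarith [pow_pos (show 0 < y by linarith) 2]
  nlinarith

/-- If all primes up to `Y^ε` divided `a`, so would their product, whose logarithm `θ(Y^ε) ≥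
Y^(ε/2)` exceeds `2 log Y`. -/
lemma eventually_exists_prime_not_dvd {ε : ℝ} (hε : 0 < ε) :
    ∀ᶠ Y : ℝ in atTop, ∀ a : ℤ, a ≠ 0 → |(a : ℝ)| ≤ Y ^ 2 →
      ∃ p : ℕ, p.Prime ∧ (p : ℝ) ≤ Y ^ ε ∧ ¬ (p : ℤ) ∣ a := by
  have h1 : ∀ᶠ Y : ℝ in atTop, 100 ≤ Y ^ (ε / 4) :=
    (tendsto_rpow_atTop (by linarith)).eventually_ge_atTop 100
  have h2 : ∀ᶠ Y : ℝ in atTop, ‖Real.log Y‖ ≤ 1 / 4 * ‖Y ^ (ε / 2)‖ :=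
    (isLittleO_log_rpow_atTop (by linarith)).bound (by norm_num)
  filter_upwards [h1, h2, eventually_gt_atTop 1] with Y hY1 hY2 hY a ha haY
  by_contra! hcon
  have hY0 : 0 < Y := by linarith
  have hdvd : primorial ⌊Y ^ ε⌋₊ ∣ a.natAbs := by
    refine Finset.prod_primes_dvd _ (fun p hp => (Finset.mem_filter.mp hp).2.prime) fun p hp => ?_
    obtain ⟨hp1, hp2⟩ := Finset.mem_filter.mp hp
    refine Int.natCast_dvd.mp (hcon p hp2 ?_)
    exact (Nat.le_floor_iff (by positivity)).mp (Nat.lt_succ_iff.mp (Finset.mem_range.mp hp1))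
  have hle : (primorial ⌊Y ^ ε⌋₊ : ℝ) ≤ Y ^ 2 := by
    refine le_trans ?_ haY
    rw [← Int.cast_abs, Int.abs_eq_natAbs]
    exact_mod_cast Nat.le_of_dvd (Int.natAbs_pos.mpr ha) hdvd
  have hth := sq_le_theta hY1
  have e1 : (Y ^ (ε / 4)) ^ 4 = Y ^ ε := by
    rw [← Real.rpow_natCast, ← Real.rpow_mul hY0.le]
    congr 1
    push_cast
    ring
  have e2 : (Y ^ (ε / 4)) ^ 2 = Y ^ (ε / 2) := by
    rw [← Real.rpow_natCast, ← Real.rpow_mul hY0.le]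
    congr 1
    push_cast
    ring
  rw [e1, e2, Chebyshev.theta_eq_log_primorial] at hth
  have hlog := Real.log_le_log (by exact_mod_cast primorial_pos _) hle
  rw [Real.log_pow] at hlog
  push_cast at hlog
  have hpos : 0 < Y ^ (ε / 2) := by positivity
  rw [Real.norm_of_nonneg hpos.le, Real.norm_of_nonneg (Real.log_nonneg hY.le)] at hY2
  linarith

/-! ### Construction of the approximations -/

lemma eventually_mul_rpow_le (a : ℝ) {b s t : ℝ} (hb : 0 < b) (hst : s < t) :
    ∀ᶠ Y : ℝ in atTop, a * Y ^ s ≤ b * Y ^ t := by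
  have h : Tendsto (fun Y : ℝ => b * Y ^ (t - s)) atTop atTop :=
    (tendsto_rpow_atTop (by linarith)).const_mul_atTop hb
  filter_upwards [h.eventually_ge_atTop a, eventually_gt_atTop 0] with Y hY hY0
  calc a * Y ^ s ≤ (b * Y ^ (t - s)) * Y ^ s := by gcongr
    _ = b * Y ^ t := by rw [mul_assoc, ← Real.rpow_add hY0, sub_add_cancel]

lemma natDegree_pos_of_abs_aeval_lt {P : ℤ[X]} {ζ : ℝ} (h : |aeval ζ P| < intMahler P) :
    0 < P.natDegree := by
  by_contra! h0
  obtain ⟨c, rfl⟩ := natDegree_eq_zero.mp (Nat.le_zero.mp h0)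
  rw [intMahler_C] at h
  simp at h

lemma coeff_zero_ne_zero_of_irreducible {P : ℤ[X]} (hP : Irreducible P) (h : 1 < intMahler P) :
    P.coeff 0 ≠ 0 := by
  intro h0
  have hd : P ∣ X := (irreducible_X.associated_of_dvd hP (X_dvd_iff.mpr h0)).symm.dvd
  have hX : intMahler X = 1 := by
    simp [intMahler, mahlerMeasure, logMahlerMeasure_X]
  linarith [intMahler_le_of_dvd X_ne_zero hd]

lemma exists_approximation {ζ η η' : ℝ} (hζ : Transcendental ℚ ζ) {m n : ℕ} (hm : 1 ≤ m)
    (hn : 1 ≤ n) (hη : 0 ≤ η) (hηη' : η < η')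
    (hw : ∃ᶠ X : ℝ in atTop, ∃ P : ℤ[X], IsPolySolution m ζ η' X P)
    (hwHat : ∀ᶠ X : ℝ in atTop, ∃ P : ℤ[X], IsPolySolution n ζ η' X P)
    {e : ℤ} (he : e = 0 ∨ e = 1) {δ : ℝ} (hδ : 0 < δ) :
    ∃ (p : ℕ) (G : ℤ[X]), p.Prime ∧ G.natDegree < m + n ∧ ¬ (p : ℤ) ∣ G.coeff 0 ∧
      C e * X ^ (m + n) + C (p : ℤ) * G ≠ 0 ∧
      ∃ α : ℝ, aeval α (C e * X ^ (m + n) + C (p : ℤ) * G) = 0 ∧ |ζ - α| < δ ∧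
        |ζ - α| ≤ (algHeight α : ℝ) ^ (-η - 1) := by
  obtain ⟨K, hK1, hK⟩ := exists_combination_root_near ζ hm hn
  set d := m + n with hd
  set θ := (η + η') / 2 with hθ
  -- Chosen so that the factor `p ≤ Y^ε` uses up half of the margin: `(1 + ε)(η + 1) = η + 1 + (θ -
  -- η)/2 < θ + 1`.
  set ε := (θ - η) / (2 * (η + 1)) with hε
  have hθη : η < θ := by rw [hθ]; linarith
  have hε0 : 0 < ε := div_pos (by linarith) (by linarith)
  have hεη : (1 + ε) * (-η - 1) = -η - 1 - (θ - η) / 2 := by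
    rw [hε]
    field_simp
    ring
  set B : ℝ := 2 ^ d * ((d + 1) * (K * 2 ^ m)) with hB
  have hB0 : 0 < B := by positivity
  have hsmall : Tendsto (fun Y : ℝ => K / 2 ^ m * Y ^ (-(θ + 1))) atTop (nhds 0) := by
    simpa using (tendsto_rpow_neg_atTop (show 0 < θ + 1 by linarith)).const_mul (K / 2 ^ m)
  have hev : ∀ᶠ Y : ℝ in atTop, 1 < Y ∧ 2 ^ m ≤ Y ∧
      (∃ Q : ℤ[X], IsPolySolution n ζ η' (Y / (n + 2)) Q) ∧
      ((n : ℝ) + 2) ^ η' * Y ^ (-η') ≤ 1 * Y ^ (-θ) ∧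
      (∀ a : ℤ, a ≠ 0 → |(a : ℝ)| ≤ Y ^ 2 →
        ∃ p : ℕ, p.Prime ∧ (p : ℝ) ≤ Y ^ ε ∧ ¬ (p : ℤ) ∣ a) ∧
      K / 2 ^ m * Y ^ (-(θ + 1)) < min 1 δ ∧
      K / 2 ^ m * Y ^ (-(θ + 1)) ≤ B ^ (-η - 1) * Y ^ ((1 + ε) * (-η - 1)) :=
    (eventually_gt_atTop 1).and <| (eventually_ge_atTop _).and <|
      ((tendsto_id.atTop_div_const (by positivity)).eventually hwHat).and <|
      (eventually_mul_rpow_le _ one_pos (by linarith)).and <|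
      (eventually_exists_prime_not_dvd hε0).and <|
      (hsmall.eventually (gt_mem_nhds (lt_min one_pos hδ))).and <|
      eventually_mul_rpow_le _ (by positivity) (by rw [hεη]; linarith)
  obtain ⟨Y₀, hY₀⟩ := eventually_atTop.mp hev
  obtain ⟨P, hPirr, hPm, hPY, hPζ⟩ :=
    frequently_irreducible hζ (show 0 ≤ θ by linarith) (show θ < η' by rw [hθ]; linarith) m hw Y₀
  obtain ⟨hY1, hYm, ⟨Q, hQn, hQH, hQ0, hQζ⟩, hQY, hprime, hlt, hfin⟩ := hY₀ _ hPY
  set Y := intMahler P with hY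
  have hY0 : 0 < Y := by linarith
  have hYθ : Y ^ (-θ) ≤ 1 := Real.rpow_le_one_of_one_le_of_nonpos hY1.le (by linarith)
  have hP0 : 0 < P.natDegree := natDegree_pos_of_abs_aeval_lt (ζ := ζ) (by linarith)
  have hPc := coeff_zero_ne_zero_of_irreducible hPirr hY1
  have hPH : (polyHeight P : ℝ) ≤ 2 ^ m * Y := polyHeight_le_intMahler hPm
  have h2m : (1 : ℝ) ≤ 2 ^ m := one_le_pow₀ (by norm_num)
  obtain ⟨p, hp, hpY, hpP⟩ := hprime _ hPc
    ((abs_coeff_le_polyHeight P 0).trans (hPH.trans (by nlinarith)))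
  have hQne : Q ≠ 0 := by rintro rfl; simp at hQ0
  -- The scale `Y / (n + 2)` serves this: it forces `M(Q) ≤ (n + 1) H(Q) < Y = M(P)`.
  have hPQ : ¬ P ∣ Q := by
    intro h
    have h1 : Y ≤ (n + 1) * (Y / (n + 2)) :=
      (intMahler_le_of_dvd hQne h).trans ((intMahler_le_polyHeight hQn).trans (by gcongr))
    have h2 : (n + 1) * (Y / (n + 2)) < Y := by
      rw [mul_div_assoc', div_lt_iff₀ (by positivity)]
      nlinarith
    linarith
  have hQH' : (polyHeight Q : ℝ) ≤ 2 ^ m * Y := by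
    have h1 : Y / (n + 2) ≤ Y :=
      div_le_self hY0.le (by have : (0 : ℝ) ≤ n := Nat.cast_nonneg n; linarith)
    nlinarith
  have hQζ' : |aeval ζ Q| ≤ Y ^ (-θ) := by
    refine hQζ.trans ?_
    rw [one_mul] at hQY
    refine le_trans (le_of_eq ?_) hQY
    rw [Real.div_rpow hY0.le (by positivity), Real.rpow_neg (by positivity : (0 : ℝ) ≤ n + 2)]
    field_simp
  have hval : K * Y ^ (-θ) / (2 ^ m * Y) = K / 2 ^ m * Y ^ (-(θ + 1)) := by
    rw [show -(θ + 1) = -θ - 1 by ring, Real.rpow_sub_one hY0.ne']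
    field_simp
  obtain ⟨G, hG, hpG, hR0, hRH, α, hα, hζα⟩ := hK P Q p (2 ^ m * Y) (Y ^ (-θ)) e hPirr hP0 hPm hQn
    hPQ hp.one_le hpP hPH hQH' hPζ hQζ' (by nlinarith)
    (by rw [hval]; exact (hlt.trans_le (min_le_left _ _)).le) he
  rw [hval] at hζα
  refine ⟨p, G, hp, hG, hpG, hR0, α, hα, hζα.trans_lt (hlt.trans_le (min_le_right _ _)),
    hζα.trans (hfin.trans ?_)⟩
  have hRd : (C e * X ^ d + C (p : ℤ) * G).natDegree ≤ d := by
    refine (natDegree_add_le _ _).trans (max_le (natDegree_C_mul_X_pow_le _ _) ?_)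
    exact (natDegree_C_mul_le _ _).trans hG.le
  have hH : (algHeight α : ℝ) ≤ B * Y ^ (1 + ε) := by
    calc (algHeight α : ℝ) ≤ 2 ^ d * ((d + 1) * (K * (p * (2 ^ m * Y)))) :=
          (algHeight_le hR0 hRd hα).trans (by gcongr)
      _ ≤ 2 ^ d * ((d + 1) * (K * (Y ^ ε * (2 ^ m * Y)))) := by gcongr
      _ = B * Y ^ (1 + ε) := by rw [hB, Real.rpow_add hY0, Real.rpow_one]; ring
  rw [Real.rpow_mul hY0.le, ← Real.mul_rpow hB0.le (by positivity)]
  have : (1 : ℝ) ≤ algHeight α := by exact_mod_cast one_le_algHeight α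
  exact Real.rpow_le_rpow_of_nonpos (by linarith) hH (by linarith)

/-- Eisenstein's criterion at `p`: the constant term `p G(0)` is not divisible by `p²`. -/
lemma irreducible_of_X_pow_add {d p : ℕ} {G : ℤ[X]} (hp : p.Prime) (hG : G.natDegree < d)
    (hpG : ¬ (p : ℤ) ∣ G.coeff 0) :
    (X ^ d + C (p : ℤ) * G).Monic ∧ (X ^ d + C (p : ℤ) * G).natDegree = d ∧
      Irreducible (X ^ d + C (p : ℤ) * G) := by
  have hpG' : (C (p : ℤ) * G).natDegree < d := (natDegree_C_mul_le _ _).trans_lt hG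
  have hdeg : (C (p : ℤ) * G).degree < d :=
    (degree_le_natDegree).trans_lt (by exact_mod_cast hpG')
  have hmon : (X ^ d + C (p : ℤ) * G).Monic := monic_X_pow_add hdeg
  have hnat : (X ^ d + C (p : ℤ) * G).natDegree = d := by
    rw [natDegree_add_eq_left_of_natDegree_lt (by rwa [natDegree_X_pow]), natDegree_X_pow]
  have hp0 : (p : ℤ) ≠ 0 := by exact_mod_cast hp.ne_zero
  have hpp : Prime (p : ℤ) := Nat.prime_iff_prime_int.mp hp
  have hprime : (Ideal.span {(p : ℤ)}).IsPrime := (Ideal.span_singleton_prime hp0).mpr hpp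
  suffices h : (X ^ d + C (p : ℤ) * G).IsEisensteinAt (Ideal.span {(p : ℤ)}) from
    ⟨hmon, hnat, h.irreducible hprime hmon.isPrimitive (by omega)⟩
  refine ⟨?_, ?_, ?_⟩
  · rw [hmon.leadingCoeff]
    exact fun h => hprime.ne_top ((Ideal.eq_top_iff_one _).mpr h)
  · intro k hk
    rw [hnat] at hk
    rw [Ideal.mem_span_singleton, coeff_add, coeff_X_pow, if_neg hk.ne, zero_add, coeff_C_mul]
    exact dvd_mul_right _ _
  · rw [Ideal.span_singleton_pow, Ideal.mem_span_singleton, coeff_add, coeff_X_pow,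
      if_neg (by omega), zero_add, coeff_C_mul, pow_two]
    exact fun h => hpG ((mul_dvd_mul_iff_left hp0).mp h)

/-- A finite set is closed, so it cannot accumulate at a point outside it. -/
lemma infinite_of_approximable {S : Set ℝ} {ζ : ℝ} (hζ : ζ ∉ S)
    (h : ∀ δ > 0, ∃ α ∈ S, |ζ - α| < δ) : S.Infinite := by
  intro hfin
  refine hζ (hfin.isClosed.closure_subset (Metric.mem_closure_iff.mpr fun δ hδ => ?_))
  obtain ⟨α, hα, hd⟩ := h δ hδ
  exact ⟨α, hα, by rwa [Real.dist_eq]⟩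

/-! ### Comparison of exponents and conclusion -/

lemma IsPolySolution.mono {n : ℕ} {ζ η η' X : ℝ} {P : ℤ[X]} (h : IsPolySolution n ζ η' X P)
    (hη : η ≤ η') (hX : 1 ≤ X) : IsPolySolution n ζ η X P :=
  ⟨h.1, h.2.1, h.2.2.1, h.2.2.2.trans (Real.rpow_le_rpow_of_exponent_le hX (by linarith))⟩

lemma wHatExp_le_wExp {k m : ℕ} (hkm : k ≤ m) (ζ : ℝ) : wHatExp k ζ ≤ wExp m ζ := by
  refine sSup_le_sSup ?_
  rintro _ ⟨η, rfl, h⟩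
  exact ⟨η, rfl, (h.mono fun X ⟨P, hP⟩ => ⟨P, hP.1.trans hkm, hP.2⟩).frequently⟩

lemma wStarExp_mono {k n : ℕ} (hkn : k ≤ n) (ζ : ℝ) : wStarExp k ζ ≤ wStarExp n ζ := by
  refine sSup_le_sSup ?_
  rintro _ ⟨η, rfl, h⟩
  exact ⟨η, rfl, h.mono fun α hα => ⟨hα.1, hα.2.1.trans hkn, hα.2.2⟩⟩

/-- Dirichlet's theorem with linear polynomials gives more than the exponent `1/2` used here;
positivity is enough to reduce the main argument to `η ≥ 0`. -/
lemma wHatExp_pos {ζ : ℝ} (hζ : Transcendental ℚ ζ) {n : ℕ} (hn : 1 ≤ n) : 0 < wHatExp n ζ := by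
  have hhalf : (0 : EReal) < ((1 / 2 : ℝ) : EReal) := by exact_mod_cast (by norm_num : (0 : ℝ) < 1 / 2)
  refine hhalf.trans_le (le_sSup ⟨1 / 2, rfl, ?_⟩)
  -- A denominator `k ≤ X / c` keeps the numerator within height: `|j| ≤ k|ζ| + 1 ≤ k c ≤ X`.
  set c : ℝ := |ζ| + 1 with hc
  have hc1 : 1 ≤ c := by have := abs_nonneg ζ; linarith
  filter_upwards [eventually_ge_atTop c,
    eventually_mul_rpow_le c one_pos (show (-1 : ℝ) < -(1 / 2) by norm_num)] with X hX hX'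
  have hX0 : 0 < X := by linarith
  have hN : 0 < ⌊X / c⌋₊ := Nat.floor_pos.mpr ((one_le_div (by linarith)).mpr hX)
  obtain ⟨j, k, hk0, hkN, hjk⟩ := Real.exists_int_int_abs_mul_sub_le ζ hN
  have hk0' : (1 : ℝ) ≤ k := by exact_mod_cast hk0
  have hkX : (k : ℝ) ≤ X / c :=
    le_trans (by exact_mod_cast hkN) (Nat.floor_le (by positivity))
  have hkX' : k * c ≤ X := (le_div_iff₀ (by linarith)).mp hkX
  have hN1 : 1 / ((⌊X / c⌋₊ : ℝ) + 1) ≤ 1 := by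
    rw [div_le_one (by positivity)]
    linarith [(Nat.cast_nonneg _ : (0 : ℝ) ≤ ⌊X / c⌋₊)]
  have hjX : |(j : ℝ)| ≤ X := by
    have h1 : |(j : ℝ)| ≤ |k * ζ| + |k * ζ - j| := by
      have := abs_sub (k * ζ) (k * ζ - j)
      rwa [sub_sub_cancel] at this
    rw [abs_mul, abs_of_pos (by linarith : (0 : ℝ) < k)] at h1
    nlinarith
  have hne : C k * Polynomial.X - C j ≠ (0 : ℤ[X]) := by
    intro h
    have := congrArg (fun P : ℤ[X] => P.coeff 1) h
    simp [-eq_intCast, coeff_C] at this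
    omega
  have hae : aeval ζ (C k * Polynomial.X - C j : ℤ[X]) = k * ζ - j := by simp
  refine ⟨C k * Polynomial.X - C j, ?_, ?_, abs_pos.mpr (aeval_ne_zero_of_transcendental hζ hne), ?_⟩
  · refine (natDegree_sub_le _ _).trans (max_le ?_ (by simp))
    exact ((natDegree_C_mul_le _ _).trans natDegree_X_le).trans hn
  · refine polyHeight_le hX0.le fun i => ?_
    rcases i with _ | _ | i
    · simpa using hjX
    · simp only [zero_add, coeff_sub, coeff_C_mul, coeff_X_one, mul_one, coeff_C, one_ne_zero,
        if_false, sub_zero]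
      rw [abs_of_pos (by linarith)]
      nlinarith
    · simpa [-eq_intCast, coeff_C, coeff_X] using hX0.le
  · rw [hae]
    refine hjk.trans (le_trans ?_ (hX'.trans_eq (one_mul _)))
    rw [Real.rpow_neg_one, ← div_eq_mul_inv, div_le_div_iff₀ (by positivity) hX0]
    have := (Nat.lt_floor_add_one (X / c)).le
    rw [div_le_iff₀ (by linarith)] at this
    linarith

lemma exists_exponent_of_lt_min {ζ η : ℝ} {m n : ℕ} (h : (η : EReal) < min (wExp m ζ) (wHatExp n ζ)) :
    ∃ η' > η, (∃ᶠ X : ℝ in atTop, ∃ P : ℤ[X], IsPolySolution m ζ η' X P) ∧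
      ∀ᶠ X : ℝ in atTop, ∃ P : ℤ[X], IsPolySolution n ζ η' X P := by
  obtain ⟨_, ⟨η₁, rfl, h₁⟩, hη₁⟩ := lt_sSup_iff.mp (lt_min_iff.mp h).1
  obtain ⟨_, ⟨η₂, rfl, h₂⟩, hη₂⟩ := lt_sSup_iff.mp (lt_min_iff.mp h).2
  refine ⟨min η₁ η₂, lt_min (by exact_mod_cast hη₁) (by exact_mod_cast hη₂), ?_, ?_⟩
  · exact (h₁.and_eventually (eventually_ge_atTop 1)).mono
      fun X ⟨⟨P, hP⟩, hX⟩ => ⟨P, hP.mono (min_le_left _ _) hX⟩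
  · exact (h₂.and (eventually_ge_atTop 1)).mono
      fun X ⟨⟨P, hP⟩, hX⟩ => ⟨P, hP.mono (min_le_right _ _) hX⟩

lemma exists_approximation_of_lt_min {ζ η : ℝ} (hζ : Transcendental ℚ ζ) {m n : ℕ} (hm : 1 ≤ m)
    (hn : 1 ≤ n) (h : (η : EReal) < min (wExp m ζ) (wHatExp n ζ)) {e : ℤ} (he : e = 0 ∨ e = 1)
    {δ : ℝ} (hδ : 0 < δ) :
    ∃ (p : ℕ) (G : ℤ[X]), p.Prime ∧ G.natDegree < m + n ∧ ¬ (p : ℤ) ∣ G.coeff 0 ∧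
      C e * X ^ (m + n) + C (p : ℤ) * G ≠ 0 ∧
      ∃ α : ℝ, aeval α (C e * X ^ (m + n) + C (p : ℤ) * G) = 0 ∧ |ζ - α| < δ ∧
        0 < |ζ - α| ∧ |ζ - α| ≤ (algHeight α : ℝ) ^ (-η - 1) := by
  -- The construction needs a nonnegative exponent. Both exponents are positive, so `η` may be
  -- raised to `max η 0`.
  have h0 : ((max η 0 : ℝ) : EReal) < min (wExp m ζ) (wHatExp n ζ) := by
    have := wHatExp_pos hζ hn
    have := (wHatExp_pos hζ hm).trans_le (wHatExp_le_wExp le_rfl ζ)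
    rcases max_choice η 0 with h' | h' <;> rw [h']
    · exact h
    · exact lt_min (by simpa) (by simpa)
  obtain ⟨η', hη', hw, hwHat⟩ := exists_exponent_of_lt_min h0
  obtain ⟨p, G, hp, hG, hpG, hR, α, hα, hd, hle⟩ :=
    exists_approximation hζ hm hn (le_max_right η 0) hη' hw hwHat he hδ
  refine ⟨p, G, hp, hG, hpG, hR, α, hα, hd, abs_pos.mpr (sub_ne_zero.mpr ?_), hle.trans ?_⟩
  · rintro rfl
    exact aeval_ne_zero_of_transcendental hζ hR hα
  · exact Real.rpow_le_rpow_of_exponent_le (by exact_mod_cast one_le_algHeight α)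
      (by linarith [le_max_left η 0])

lemma min_le_wStarExp {ζ : ℝ} (hζ : Transcendental ℚ ζ) {m n : ℕ} (hm : 1 ≤ m) (hn : 1 ≤ n) :
    min (wExp m ζ) (wHatExp n ζ) ≤ wStarExp (m + n - 1) ζ := by
  refine EReal.ge_of_forall_gt_iff_ge.mp fun η hη => le_sSup ⟨η, rfl, ?_⟩
  refine infinite_of_approximable (ζ := ζ) (fun h => by simpa using h.2.2.1) fun δ hδ => ?_
  obtain ⟨p, G, hp, hG, -, hR, α, hα, hd, hpos, hle⟩ :=
    exists_approximation_of_lt_min hζ hm hn hη (Or.inl rfl) hδ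
  refine ⟨α, ⟨IsAlgebraic.extendScalars (R := ℤ) (algebraMap ℤ ℚ).injective_int ⟨_, hR, hα⟩,
    (minpoly_natDegree_le hR hα).trans ?_, hpos, hle⟩, hd⟩
  rw [C_0, zero_mul, zero_add]
  exact (natDegree_C_mul_le _ _).trans (by omega)

lemma algIntSolutions_infinite {ζ η : ℝ} (hζ : Transcendental ℚ ζ) {m n : ℕ} (hm : 1 ≤ m)
    (hn : 1 ≤ n) (hη : (η : EReal) < min (wExp m ζ) (wHatExp n ζ)) :
    (algIntSolutions (m + n) ζ η).Infinite := by
  refine infinite_of_approximable (ζ := ζ) (fun h => by simpa using h.2.2.1) fun δ hδ => ?_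
  obtain ⟨p, G, hp, hG, hpG, -, α, hα, hd, hpos, hle⟩ :=
    exists_approximation_of_lt_min hζ hm hn hη (Or.inr rfl) hδ
  rw [C_1, one_mul] at hα
  obtain ⟨hmon, hnat, hirr⟩ := irreducible_of_X_pow_add hp hG hpG
  have hmin : minpoly ℚ α = (X ^ (m + n) + C (p : ℤ) * G).map (algebraMap ℤ ℚ) :=
    (minpoly.eq_of_irreducible_of_monic
      ((hmon.irreducible_iff_irreducible_map_fraction_map (K := ℚ)).mp hirr)
      (by rwa [aeval_map_algebraMap]) (hmon.map _)).symm
  refine ⟨α, ⟨⟨_, hmon, hα⟩, ?_, hpos, hle⟩, hd⟩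
  rw [hmin, hmon.natDegree_map, hnat]

theorem mainTheorem4 (ζ : ℝ) (hζ : Transcendental ℚ ζ) :
    (∀ m n : ℕ, 1 ≤ m → 1 ≤ n →
      min (wExp m ζ) (wHatExp n ζ) ≤ wStarExp (m + n - 1) ζ) ∧
    (∀ n : ℕ, 1 ≤ n → wHatExp ⌈(n : ℝ) / 2⌉₊ ζ ≤ wStarExp n ζ) ∧
    (∀ m n : ℕ, 1 ≤ m → 1 ≤ n →
      ∀ η : ℝ, (η : EReal) < min (wExp m ζ) (wHatExp n ζ) →
        (algIntSolutions (m + n) ζ η).Infinite) ∧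
    (∀ n : ℕ, 1 ≤ n →
      ∀ η : ℝ, (η : EReal) < wHatExp ⌈(n : ℝ) / 2⌉₊ ζ →
        (algIntSolutions (n + 1) ζ η).Infinite) := by
  have hceil : ∀ n : ℕ, 1 ≤ n → 1 ≤ ⌈(n : ℝ) / 2⌉₊ ∧ 2 * ⌈(n : ℝ) / 2⌉₊ ≤ n + 1 := by
    intro n hn
    have hn' : (0 : ℝ) < n := by exact_mod_cast hn
    refine ⟨Nat.ceil_pos.mpr (by positivity), ?_⟩
    have h := Nat.ceil_lt_add_one (show 0 ≤ (n : ℝ) / 2 by positivity)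
    have h' : ((2 * ⌈(n : ℝ) / 2⌉₊ : ℕ) : ℝ) < (n + 2 : ℕ) := by
      push_cast
      linarith
    have := Nat.cast_lt.mp h'
    omega
  refine ⟨fun m n hm hn => min_le_wStarExp hζ hm hn, fun n hn => ?_,
    fun m n hm hn η hη => algIntSolutions_infinite hζ hm hn hη, fun n hn η hη => ?_⟩
  · obtain ⟨h1, h2⟩ := hceil n hn
    exact (le_min (wHatExp_le_wExp le_rfl ζ) le_rfl).trans
      ((min_le_wStarExp hζ h1 h1).trans (wStarExp_mono (by omega) ζ))
  · obtain ⟨h1, h2⟩ := hceil n hn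
    -- The degree must be exactly `n + 1`, so with `k = ⌈n/2⌉` take `m = n + 1 - k`; then `k ≤ m`,
    -- because `2k ≤ n + 1`.
    have h := algIntSolutions_infinite hζ (m := n + 1 - ⌈(n : ℝ) / 2⌉₊) (by omega) h1
      (lt_min (hη.trans_le (wHatExp_le_wExp (by omega) ζ)) hη)
    rwa [Nat.sub_add_cancel (by omega)] at h
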